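/- Let $f\in C^\infty(\mathbb R^d)$ be a (complex valued) function that defines a tempered distribution, let $P$ be a polynomial in $d$ variables with complex coefficients, and let $P(\partial)$ be the corresponding constant coefficient differential operator, so that $P(\partial)e^{i\lambda\cdot x}=P(i\lambda)e^{i\lambda\cdot x}$. Let $\mathcal F$ denote the Fourier transform on tempered distributions, $\langle \mathcal F T,\phi\rangle=\langle T,\mathcal F\phi\rangle$, where $\mathcal F\phi(\lambda)=(2\pi)^{-d/2}\int_{\mathbb R^d}\phi(x)e^{-i\lambda\cdot x}\,dx$ for Schwartz functions $\phi$. Write $\mathbb N=\{1,2,\dots\}$ and $\mathbb N_0=\mathbb N\cup\{0\}$. (1) Let $R_0\ge 0$ be such that $\{\lambda\in\mathbb R^d: |P(i\lambda)|\le R_0\}$ is compact. Then $\operatorname{supp}\mathcal F f\subset\{\lambda\in\mathbb R^d:|P(i\lambda)|\le R_0\}$ if and only if, for each $R>R_0$, there exist constants $N_R\in\mathbb N_0$ and $C_R\ge 0$ such that $$|P(\partial)^n f(x)|\le C_R\, n^{N_R} R^n (1+|x|)^{N_R}\qquad\text{for all } n\in\mathbb N \text{ and } x\in\mathbb R^d.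 \tag{$*$}$$ If this is the case, then $\mathcal F f$ has finite order $N$, and for all $R>R_0$ one can take $N_R=N$ in $(*)$ (with a suitable $C_R\ge0$). Here the order of a distribution $T$ is the least $N\in\mathbb N_0$ such that for each compact $K\subset\mathbb R^d$ there is a constant $C$ with $|\langle T,\phi\rangle|\le C\sum_{|\alpha|\le N}\|\partial^\alpha\phi\|_\infty$ for all $\phi\in C_c^\infty(\mathbb R^d)$ supported in $K$. (2) No compactness is needed in the following implication: if there are $N\in\mathbb N_0$ and constants $C,R\ge 0$ such that $|P(\partial)^n f(x)|\le C n^N R^n(1+|x|)^N$ for all $n\in\mathbb N$ and $x\in\mathbb R^d$, then $\operatorname{supp}\mathcal F f\subset\{\lambda\in\mathbb R^d:|P(i\lambda)|\le R\}$. -/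

import Mathlib

open MeasureTheory SchwartzMap FourierTransform
open scoped ContDiff

noncomputable section

namespace RealPaleyWiener

/-- The space `ℝ^d` with its Euclidean norm. -/
abbrev Rd (d : ℕ) : Type := EuclideanSpace ℝ (Fin d)

variable {d : ℕ}

/-! ### Polynomials and constant coefficient differential operators -/

/-- The value `P(iξ)` of a complex polynomial `P` in `d` variables, for `ξ ∈ ℝ^d`. -/
def evalI (P : MvPolynomial (Fin d) ℂ) (ξ : Rd d) : ℂ :=
  MvPolynomial.eval (fun j => Complex.I * (ξ j : ℂ)) P

/-- The partial derivative `∂_j g`. -/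
def partialDeriv (j : Fin d) (g : Rd d → ℂ) : Rd d → ℂ :=
  fun x => fderiv ℝ g x (EuclideanSpace.single j 1)

/-- The iterated partial derivative `∂^α g = ∂_0^{α_0} ⋯ ∂_{d-1}^{α_{d-1}} g`. -/
def multiDeriv (α : Fin d →₀ ℕ) (g : Rd d → ℂ) : Rd d → ℂ :=
  (List.finRange d).foldr (fun j h => (partialDeriv j)^[α j] h) g

/-- The operator `P(∂)`, acting as `P(∂) g = ∑_α c_α ∂^α g` for `P = ∑_α c_α X^α`. -/
def polyDeriv (P : MvPolynomial (Fin d) ℂ) (g : Rd d → ℂ) : Rd d → ℂ :=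
  fun x => ∑ α ∈ P.support, MvPolynomial.coeff α P * multiDeriv α g x

/-! ### The Fourier transform -/

/-- The dilation `ξ ↦ (2π)⁻¹ ξ` of `ℝ^d`. -/
def dilation (d : ℕ) : Rd d ≃L[ℝ] Rd d :=
  ContinuousLinearEquiv.smulLeft (Units.mk0 ((2 * Real.pi)⁻¹) (by positivity))

/-- The Fourier transform on Schwartz functions, normalized as
`(𝓕 φ)(ξ) = (2π)^{-d/2} ∫ e^{-i ξ·x} φ(x) dx`; see `angularFourier_apply`. It is obtained from
Mathlib's transform `∫ e^{-2πi ξ·x} φ(x) dx` by rescaling. -/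
def angularFourier (d : ℕ) : 𝓢(Rd d, ℂ) →L[ℂ] 𝓢(Rd d, ℂ) :=
  (((2 * Real.pi) ^ (-(d : ℝ) / 2) : ℝ) : ℂ) •
    ((SchwartzMap.compCLMOfContinuousLinearEquiv ℂ (dilation d)).comp
      (fourierCLM ℂ 𝓢(Rd d, ℂ)))

theorem angularFourier_apply (φ : 𝓢(Rd d, ℂ)) (ξ : Rd d) :
    angularFourier d φ ξ = (((2 * Real.pi) ^ (-(d : ℝ) / 2) : ℝ) : ℂ) *
      ∫ x : Rd d, Complex.exp (-Complex.I * ((∑ j, ξ j * x j : ℝ) : ℂ)) * φ x := by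
  have h : angularFourier d φ ξ = (((2 * Real.pi) ^ (-(d : ℝ) / 2) : ℝ) : ℂ) *
      (𝓕 φ : 𝓢(Rd d, ℂ)) ((2 * Real.pi)⁻¹ • ξ) := rfl
  rw [h, SchwartzMap.fourier_coe, Real.fourier_eq']
  congr 1
  refine integral_congr_ae (Filter.Eventually.of_forall fun x => ?_)
  simp only [smul_eq_mul]
  congr 2
  rw [inner_smul_right, PiLp.inner_apply]
  have hpi : (Real.pi : ℂ) ≠ 0 := by exact_mod_cast Real.pi_ne_zero
  simp only [RCLike.inner_apply, conj_trivial]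
  push_cast
  field_simp

/-- The Fourier transform of a tempered distribution, `⟨𝓕 T, φ⟩ = ⟨T, 𝓕 φ⟩`. -/
def distFourier (T : 𝓢'(Rd d, ℂ)) : 𝓢'(Rd d, ℂ) :=
  PointwiseConvergenceCLM.precomp ℂ (angularFourier d) T

/-! ### Functions as distributions, and the order of a distribution -/

/-- The (locally integrable) function `f` is, as a distribution, the tempered distribution `T`:
`⟨T, φ⟩ = ∫ f φ` for every test function `φ ∈ C_c^∞(ℝ^d)`. By density of `C_c^∞` in the Schwartz
space, `T` is determined by `f`. No growth condition on `f` is imposed. -/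
def Represents (f : Rd d → ℂ) (T : 𝓢'(Rd d, ℂ)) : Prop :=
  ∀ φ : 𝓢(Rd d, ℂ), HasCompactSupport φ → T φ = ∫ x, f x * φ x

/-- `T` has order at most `N`: for every compact `K` there is a constant `C` with
`|⟨T, φ⟩| ≤ C ∑_{k ≤ N} sup_x ‖D^k φ(x)‖` for all `φ ∈ C_c^∞` supported in `K`. The seminorm
`SchwartzMap.seminorm ℂ 0 k` is the supremum norm of the `k`-th total derivative, which is
equivalent to `∑_{|α| = k} sup |∂^α φ|`. -/
def HasOrderAtMost (T : 𝓢'(Rd d, ℂ)) (N : ℕ) : Prop :=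
  ∀ K : Set (Rd d), IsCompact K → ∃ C : ℝ, ∀ φ : 𝓢(Rd d, ℂ), tsupport φ ⊆ K →
    ‖T φ‖ ≤ C * ∑ k ∈ Finset.range (N + 1), SchwartzMap.seminorm ℂ 0 k φ

/-- The order of `T`: the least `N` such that `T` has order at most `N`, and `⊤` if there is
none. -/
def distOrder (T : 𝓢'(Rd d, ℂ)) : ℕ∞ :=
  ⨅ (N : ℕ) (_ : HasOrderAtMost T N), (N : ℕ∞)

/-! ### The growth estimate -/

/-- `|P(∂)^n f(x)| ≤ C n^N R^n (1+|x|)^N` for all integers `n ≥ 1` and all `x ∈ ℝ^d`. -/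
def GrowthBound (P : MvPolynomial (Fin d) ℂ) (f : Rd d → ℂ) (N : ℕ) (C R : ℝ) : Prop :=
  ∀ n : ℕ, 1 ≤ n → ∀ x : Rd d,
    ‖((polyDeriv P)^[n] f) x‖ ≤ C * (n : ℝ) ^ N * R ^ n * (1 + ‖x‖) ^ N

end RealPaleyWiener

end

noncomputable section

namespace RealPaleyWiener

variable {d : ℕ}

open Filter Topology LineDeriv
open scoped Manifold

/-! The Fourier transform turns `P(-∂)` into multiplication by `P(iξ)`. With integration by parts,
`∫ (P(∂)^n f) 𝓕w = ⟨𝓕T, P(iξ)^n w⟩` whenever `𝓕w` is a test function. Both directions read off this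
identity, using that derivatives of order `l` of `g^n φ` are `O((n+1)^l r^n)` if `|g| ≤ r` on the
support of `φ` (`exists_bound_iteratedFDeriv_pow_smul`).

Support implies growth (`growthBound_of_dsupport_subset`): a value at `x` is controlled by means
against bumps `𝓕w` of mass at most one near `x`, and the `k`-th derivatives of such `w` are
`O((1+|x|)^k)`. Since `𝓕T` vanishes off the compact sublevel set, `P^n w` may be multiplied by a
cutoff supported in `|P(iξ)| < R`. If `𝓕T` has order `N`, at most `N` derivatives fall on `P^n χ w`,
which gives `n^N R^n (1+|x|)^N` with the same `N` for every `R`.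

Growth implies support (`dsupport_subset_of_growthBound`): near a point with `|P(iξ)| > ρ > R`, a
test function `ψ` can be divided by `P^n`. Then `⟨𝓕T, ψ⟩` is the integral of `P(∂)^n f` against
`𝓕(ψ/P^n)`, hence at most a polynomial in `n` times `(R/ρ)^n`, and so zero. -/

/-! ### Derivative bounds and truncation of Schwartz functions. -/

theorem _root_.ContDiff.exists_bound_iteratedFDeriv_of_hasCompactSupport {E F : Type*}
    [NormedAddCommGroup E] [NormedSpace ℝ E] [NormedAddCommGroup F] [NormedSpace ℝ F]
    {φ : E → F} (hφ : ContDiff ℝ ∞ φ) (hc : HasCompactSupport φ) (l : ℕ) :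
    ∃ C, 0 ≤ C ∧ ∀ x, ‖iteratedFDeriv ℝ l φ x‖ ≤ C := by
  obtain ⟨C, hC⟩ := (hc.iteratedFDeriv (𝕜 := ℝ) l).exists_bound_of_continuous
    (hφ.continuous_iteratedFDeriv (m := l) (mod_cast le_top))
  exact ⟨C, (norm_nonneg _).trans (hC 0), hC⟩

/-- Derivatives of `g ^ n • φ` grow at most like `n ^ l * r ^ n` when `|g| ≤ r` on the support
of `φ`. -/
theorem exists_bound_iteratedFDeriv_pow_smul {E : Type} [NormedAddCommGroup E] [NormedSpace ℝ E]
    {g : E → ℂ} (hg : ContDiff ℝ ∞ g) {r : ℝ} (hr : 0 < r) (l : ℕ) :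
    ∀ {F : Type} [NormedAddCommGroup F] [NormedSpace ℝ F] [NormedSpace ℂ F] [IsScalarTower ℝ ℂ F]
      {φ : E → F}, ContDiff ℝ ∞ φ → HasCompactSupport φ → (∀ x ∈ tsupport φ, ‖g x‖ ≤ r) →
      ∃ C, 0 ≤ C ∧ ∀ (n : ℕ) (x : E),
        ‖iteratedFDeriv ℝ l (fun y => g y ^ n • φ y) x‖ ≤ C * ((n : ℝ) + 1) ^ l * r ^ n := by
  induction l with
  | zero =>
    intro F _ _ _ _ φ hφ hc hgr
    obtain ⟨C, hC⟩ := hc.exists_bound_of_continuous hφ.continuous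
    have hC0 : 0 ≤ C := (norm_nonneg _).trans (hC 0)
    refine ⟨C, hC0, fun n x => ?_⟩
    rw [norm_iteratedFDeriv_zero, norm_smul, norm_pow, pow_zero, mul_one, mul_comm]
    by_cases hx : x ∈ tsupport φ
    · have := hC x
      have := hgr x hx
      gcongr
    · rw [image_eq_zero_of_notMem_tsupport hx, norm_zero, zero_mul]
      positivity
  | succ l ih =>
    intro F _ _ _ _ φ hφ hc hgr
    have hg' : ContDiff ℝ ∞ (fderiv ℝ g) := hg.fderiv_right (m := ∞) (by simp)
    have hφ' : ContDiff ℝ ∞ (fderiv ℝ φ) := hφ.fderiv_right (m := ∞) (by simp)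
    -- The product rule reads `D(g^n φ) = g^n Dφ + n g^(n-1) (φ ⊗ Dg)`. Both terms have the original
    -- shape with values in `E →L[ℝ] F`, which is why the induction ranges over all `F`.
    let dsmul : E → E →L[ℝ] F := fun x =>
      ((ContinuousLinearMap.lsmul ℝ ℂ).flip (φ x)).comp (fderiv ℝ g x)
    have hψ : ContDiff ℝ ∞ dsmul :=
      ((ContinuousLinearMap.contDiff _).comp hφ).clm_comp hg'
    have hψs : Function.support dsmul ⊆
        Function.support φ := by
      intro x hx h
      apply hx
      ext v
      simp [dsmul, show φ x = 0 from h]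
    have hψc : HasCompactSupport dsmul := hc.mono hψs
    obtain ⟨C₁, hC₁, h₁⟩ := ih hφ' (hc.fderiv (𝕜 := ℝ))
      (fun x hx => hgr x (tsupport_fderiv_subset ℝ hx))
    obtain ⟨C₂, hC₂, h₂⟩ := ih hψ hψc (fun x hx => hgr x (closure_mono hψs hx))
    -- The division by `r` restores `r ^ n` from the power `g ^ (n - 1)`; the factor `n` accounts
    -- for the extra power of `n + 1`.
    refine ⟨C₁ + C₂ / r, by positivity, fun n x => ?_⟩
    have hd : fderiv ℝ (fun y => g y ^ n • φ y) =
        (fun y => g y ^ n • fderiv ℝ φ y) +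
          fun y => (n : ℂ) • (g y ^ (n - 1) • dsmul y) := by
      ext y v
      have hgy : DifferentiableAt ℝ g y := hg.differentiable (by simp) y
      have hφy : DifferentiableAt ℝ φ y := hφ.differentiable (by simp) y
      have := (hgy.hasFDerivAt.pow n |>.smul hφy.hasFDerivAt).fderiv
      change fderiv ℝ ((fun x => g x ^ n) • φ) y v = _
      rw [this]
      simp [dsmul, smul_smul, mul_assoc]
    have hs₁ : ContDiff ℝ ∞ (fun y => g y ^ n • fderiv ℝ φ y) := (hg.pow n).smul hφ'
    have hs₂ : ContDiff ℝ ∞ (fun y => g y ^ (n - 1) • dsmul y) :=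
      (hg.pow _).smul hψ
    have hs₃ : ContDiff ℝ ∞ (fun y => (n : ℂ) • (g y ^ (n - 1) • dsmul y)) :=
      hs₂.const_smul (n : ℂ)
    rw [← norm_iteratedFDeriv_fderiv, hd, iteratedFDeriv_add_apply
      (hs₁.contDiffAt.of_le (mod_cast le_top))
      (hs₃.contDiffAt.of_le (mod_cast le_top))]
    have e₂ : iteratedFDeriv ℝ l
        (fun y => (n : ℂ) • (g y ^ (n - 1) • dsmul y)) x =
        (n : ℂ) • iteratedFDeriv ℝ l
          (fun y => g y ^ (n - 1) • dsmul y) x :=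
      iteratedFDeriv_const_smul_apply' (hs₂.contDiffAt.of_le (mod_cast le_top))
    rw [e₂]
    refine (norm_add_le _ _).trans ?_
    rw [norm_smul, Complex.norm_natCast]
    have b₁ : ‖iteratedFDeriv ℝ l (fun y => g y ^ n • fderiv ℝ φ y) x‖ ≤
        C₁ * ((n : ℝ) + 1) ^ (l + 1) * r ^ n := by
      refine (h₁ n x).trans ?_
      gcongr
      · simp
      · omega
    have b₂ : (n : ℝ) * ‖iteratedFDeriv ℝ l
        (fun y => g y ^ (n - 1) • dsmul y) x‖ ≤
        C₂ / r * ((n : ℝ) + 1) ^ (l + 1) * r ^ n := by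
      -- For `n = 0` the truncated exponent `n - 1` is harmless, as the prefactor `n` kills the
      -- term.
      rcases n with _ | n
      · simp only [Nat.cast_zero, zero_mul]; positivity
      · have := h₂ n x
        calc _ ≤ ((n + 1 : ℕ) : ℝ) * (C₂ * ((n : ℝ) + 1) ^ l * r ^ n) := by
              gcongr
              exact this
          _ ≤ (((n + 1 : ℕ) : ℝ) + 1) * (C₂ * (((n + 1 : ℕ) : ℝ) + 1) ^ l * r ^ n) := by
              gcongr
              · simp
              · simp
          _ = _ := by
              field_simp
              ring
    linarith

/-- Multiplication by a dilate `η (c x)` of a function `η` vanishing on the unit ball has size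
`O(c)` on the Schwartz space. -/
theorem exists_bound_dilate_smul {η : Rd d → ℝ} (hη : ContDiff ℝ ∞ η)
    (hη0 : ∀ x, ‖x‖ ≤ 1 → η x = 0) {B : ℕ → ℝ} (hB : ∀ i x, ‖iteratedFDeriv ℝ i η x‖ ≤ B i)
    (v : 𝓢(Rd d, ℂ)) (m l : ℕ) :
    ∃ S, 0 ≤ S ∧ ∀ c : ℝ, 0 < c → c ≤ 1 → ∀ x,
      ‖x‖ ^ m * ‖iteratedFDeriv ℝ l (fun x => η (c • x) • v x) x‖ ≤ c * S := by
  have hB0 : ∀ i, 0 ≤ B i := fun i => (norm_nonneg _).trans (hB i 0)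
  let S : ℝ := ∑ i ∈ Finset.range (l + 1),
    (l.choose i : ℝ) * B i * SchwartzMap.seminorm ℝ (m + 1) (l - i) v
  have hS : 0 ≤ S := Finset.sum_nonneg fun i _ => by have := hB0 i; positivity
  refine ⟨S, hS, fun c hc hc1 x => ?_⟩
  by_cases hx : c * ‖x‖ < 1
  · have : (fun x => η (c • x) • v x) =ᶠ[𝓝 x] fun _ => 0 := by
      have ho : IsOpen {y : Rd d | c * ‖y‖ < 1} := isOpen_lt (by fun_prop) (by fun_prop)
      filter_upwards [ho.mem_nhds hx] with y hy
      rw [hη0 (c • y) (by rw [norm_smul, Real.norm_of_nonneg hc.le]; exact le_of_lt hy), zero_smul]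
    rw [(this.iteratedFDeriv ℝ l).eq_of_nhds]
    simp only [iteratedFDeriv_fun_zero, Pi.zero_apply, norm_zero, mul_zero]
    positivity
  push Not at hx
  -- Away from the ball where the dilate vanishes, `1 ≤ c ‖x‖`: one extra power of `‖x‖`, absorbed
  -- by the decay of `v`, buys the factor `c`.
  have hx' : ‖x‖ ^ m ≤ c * ‖x‖ ^ (m + 1) := by
    calc ‖x‖ ^ m ≤ ‖x‖ ^ m * (c * ‖x‖) := le_mul_of_one_le_right (by positivity) hx
      _ = _ := by ring
  have hsm' : ContDiff ℝ ∞ fun x : Rd d => η (c • x) := hη.comp (contDiff_const_smul c)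
  have hL := norm_iteratedFDeriv_smul_le (n := l) (N := ∞) hsm' (v.smooth ⊤) x
    (mod_cast le_top)
  calc _ ≤ c * ‖x‖ ^ (m + 1) * ∑ i ∈ Finset.range (l + 1),
        (l.choose i : ℝ) * ‖iteratedFDeriv ℝ i (fun x : Rd d => η (c • x)) x‖ *
          ‖iteratedFDeriv ℝ (l - i) v x‖ :=
        mul_le_mul hx' hL (norm_nonneg _) (by positivity)
    _ = c * ∑ i ∈ Finset.range (l + 1),
        (l.choose i : ℝ) * ‖iteratedFDeriv ℝ i (fun x : Rd d => η (c • x)) x‖ *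
          (‖x‖ ^ (m + 1) * ‖iteratedFDeriv ℝ (l - i) v x‖) := by
        rw [mul_assoc, Finset.mul_sum]
        congr 1
        exact Finset.sum_congr rfl fun i _ => by ring
    _ ≤ c * S := by
        refine mul_le_mul_of_nonneg_left (Finset.sum_le_sum fun i _ => ?_) hc.le
        have h1 : ‖iteratedFDeriv ℝ i (fun x : Rd d => η (c • x)) x‖ ≤ B i := by
          rw [iteratedFDeriv_comp_const_smul _ (hη.of_le (mod_cast le_top)), norm_smul,
            norm_pow, Real.norm_of_nonneg hc.le]
          exact (mul_le_of_le_one_left (norm_nonneg _) (pow_le_one₀ hc.le hc1)).trans (hB i _)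
        exact mul_le_mul (mul_le_mul_of_nonneg_left h1 (Nat.cast_nonneg _))
          (SchwartzMap.le_seminorm ℝ (m + 1) (l - i) v x) (by positivity)
          (mul_nonneg (Nat.cast_nonneg _) (hB0 i))

/-- Every Schwartz function is a limit of its truncations, which have compact support. -/
theorem exists_truncation_tendsto (v : 𝓢(Rd d, ℂ)) :
    ∃ u : ℕ → 𝓢(Rd d, ℂ), (∀ k, HasCompactSupport (u k)) ∧ (∀ k, tsupport (u k) ⊆ tsupport v) ∧
      (∀ k x, ‖u k x‖ ≤ ‖v x‖) ∧ Tendsto u atTop (𝓝 v) := by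
  obtain ⟨b, hb, hbc, hb01, hb1⟩ : ∃ b : Rd d → ℝ, ContDiff ℝ ∞ b ∧ HasCompactSupport b ∧
      (∀ x, b x ∈ Set.Icc 0 1) ∧ ∀ x, ‖x‖ ≤ 1 → b x = 1 := by
    let b : ContDiffBump (0 : Rd d) := ⟨1, 2, one_pos, one_lt_two⟩
    exact ⟨b, b.contDiff, b.hasCompactSupport, fun x => ⟨b.nonneg, b.le_one⟩,
      fun x hx => b.one_of_mem_closedBall (mem_closedBall_zero_iff.2 hx)⟩
  obtain ⟨c, hc, hc1, hct⟩ : ∃ c : ℕ → ℝ, (∀ k, 0 < c k) ∧ (∀ k, c k ≤ 1) ∧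
      Tendsto c atTop (𝓝 0) :=
    ⟨fun k => 1 / ((k : ℝ) + 1), fun k => by positivity,
      fun k => by
        simpa only [one_div] using inv_le_one_of_one_le₀ (by simp),
      tendsto_one_div_add_atTop_nhds_zero_nat⟩
  have hcs : ∀ k, HasCompactSupport fun x : Rd d => b (c k • x) := fun k =>
    hbc.comp_homeomorph (Homeomorph.smulOfNeZero (c k) (hc k).ne')
  have hsm : ∀ k, ContDiff ℝ ∞ fun x : Rd d => b (c k • x) := fun k =>
    hb.comp (contDiff_const_smul _)
  have hcv : ∀ k, HasCompactSupport fun x : Rd d => b (c k • x) • v x := by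
    refine fun k => (hcs k).mono fun x hx => ?_
    contrapose! hx
    simp only [Function.mem_support, not_not] at hx ⊢
    rw [hx, zero_smul]
  have hu : ∀ k, ∃ u : 𝓢(Rd d, ℂ), ⇑u = fun x => b (c k • x) • v x := by
    intro k
    have h1 := hcv k
    have h2 : ContDiff ℝ ∞ fun x : Rd d => b (c k • x) • v x := (hsm k).smul (v.smooth ⊤)
    exact ⟨h1.toSchwartzMap h2, rfl⟩
  choose u hu using hu
  refine ⟨u, fun k => (hu k).symm ▸ hcv k,
    fun k => hu k ▸ tsupport_smul_subset_right _ _, fun k x => ?_, ?_⟩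
  · rw [hu, norm_smul, Real.norm_of_nonneg (hb01 _).1]
    exact mul_le_of_le_one_left (norm_nonneg _) (hb01 _).2
  -- The truncation error is `η (c_k x) v x`, and `η` vanishes on the unit ball, so every Schwartz
  -- seminorm of the error is `O(c_k)`.
  let η : Rd d → ℝ := fun x => b x - 1
  have hη : ContDiff ℝ ∞ η := hb.sub contDiff_const
  have hη0 : ∀ x, ‖x‖ ≤ 1 → η x = 0 := fun x hx =>
    sub_eq_zero.2 (hb1 x hx)
  have hηb : ∀ i, ∃ B, ∀ x, ‖iteratedFDeriv ℝ i η x‖ ≤ B := by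
    intro i
    obtain ⟨B, hB, hB'⟩ := hb.exists_bound_iteratedFDeriv_of_hasCompactSupport
      hbc i
    refine ⟨B + 1, fun x => ?_⟩
    have : iteratedFDeriv ℝ i η x = iteratedFDeriv ℝ i b x -
        iteratedFDeriv ℝ i (fun _ : Rd d => (1 : ℝ)) x :=
      iteratedFDeriv_sub_apply (hb.contDiffAt.of_le (mod_cast le_top)) contDiffAt_const
    rw [this]
    refine (norm_sub_le _ _).trans (add_le_add (hB' x) ?_)
    rcases i with _ | i
    · simp
    · simp [iteratedFDeriv_const_of_ne]
  choose B hB using hηb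
  rw [(schwartz_withSeminorms ℝ (Rd d) ℂ).tendsto_nhds]
  rintro ⟨m, l⟩ ε hε
  obtain ⟨S, hS, hS'⟩ := exists_bound_dilate_smul hη hη0 hB v m l
  have ht : Tendsto (fun k => c k * S) atTop (𝓝 0) := by
    simpa using hct.mul_const S
  filter_upwards [ht.eventually (gt_mem_nhds hε)] with k hk
  change SchwartzMap.seminorm ℝ m l (u k - v) < ε
  refine lt_of_le_of_lt ?_ hk
  refine SchwartzMap.seminorm_le_bound ℝ m l _ (mul_nonneg (hc k).le hS) fun x => ?_
  have hf : (⇑(u k - v) : Rd d → ℂ) = fun x => η (c k • x) • v x := by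
    ext x
    rw [sub_apply, hu, sub_smul, one_smul]
  rw [hf]
  exact hS' (c k) (hc k) (hc1 k) x

/-! ### Finite order of tempered distributions. -/

/-- On functions supported in a fixed compact set, a continuous seminorm is controlled by
the supremum norms of finitely many derivatives. -/
theorem exists_bound_of_tsupport_subset {q : Seminorm ℂ 𝓢(Rd d, ℂ)} (hq : Continuous q) :
    ∃ L : ℕ, ∀ K : Set (Rd d), IsCompact K → ∃ C : ℝ, 0 ≤ C ∧ ∀ v : 𝓢(Rd d, ℂ), tsupport v ⊆ K →
      q v ≤ C * ∑ k ∈ Finset.range (L + 1), SchwartzMap.seminorm ℂ 0 k v := by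
  obtain ⟨s, C, -, hC⟩ := Seminorm.bound_of_continuous
    (schwartz_withSeminorms ℂ (Rd d) ℂ) q hq
  -- The number of derivatives depends only on `q`. The set `K` enters through the polynomial
  -- weights, which are bounded on it, and so affects only the constant.
  let L := s.sup Prod.snd
  refine ⟨L, fun K hK => ?_⟩
  obtain ⟨ρ, hρ⟩ := hK.isBounded.exists_norm_le
  let a : ℝ := max ρ 1
  have ha : 1 ≤ a := le_max_right _ _
  let S : ℝ := ∑ i ∈ s, a ^ i.1
  have hS : 0 ≤ S := Finset.sum_nonneg fun i _ => by positivity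
  refine ⟨C * S, by positivity, fun v hv => ?_⟩
  set σ : ℝ := ∑ k ∈ Finset.range (L + 1), SchwartzMap.seminorm ℂ 0 k v
  have h1 : ∀ i ∈ s, SchwartzMap.seminorm ℂ i.1 i.2 v ≤ a ^ i.1 * σ := by
    intro i hi
    have hi' : SchwartzMap.seminorm ℂ 0 i.2 v ≤ σ :=
      Finset.single_le_sum (f := fun k => SchwartzMap.seminorm ℂ 0 k v)
        (fun k _ => apply_nonneg _ _)
        (Finset.mem_range.2 (Nat.lt_succ_of_le (Finset.le_sup (f := Prod.snd) hi)))
    refine (SchwartzMap.seminorm_le_bound ℂ i.1 i.2 v (M := a ^ i.1 *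
      SchwartzMap.seminorm ℂ 0 i.2 v) (by positivity) fun x => ?_).trans (by gcongr)
    by_cases hx : x ∈ K
    · have h2 := SchwartzMap.norm_iteratedFDeriv_le_seminorm ℂ v i.2 x
      have h3 : ‖x‖ ≤ a := (hρ x hx).trans (le_max_left _ _)
      gcongr
    · have : iteratedFDeriv ℝ i.2 v x = 0 := image_eq_zero_of_notMem_tsupport fun h =>
        hx (hv (tsupport_iteratedFDeriv_subset i.2 h))
      rw [this, norm_zero, mul_zero]
      positivity
  calc q v ≤ (C • s.sup (schwartzSeminormFamily ℂ (Rd d) ℂ)) v := hC v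
    _ ≤ C * ∑ i ∈ s, SchwartzMap.seminorm ℂ i.1 i.2 v := by
        refine mul_le_mul_of_nonneg_left (Seminorm.finset_sup_apply_le
          (Finset.sum_nonneg fun i _ => apply_nonneg _ _) fun i hi => ?_) C.2
        exact Finset.single_le_sum (f := fun i : ℕ × ℕ => SchwartzMap.seminorm ℂ i.1 i.2 v)
          (fun k _ => apply_nonneg _ _) hi
    _ ≤ C * ∑ i ∈ s, a ^ i.1 * σ := by
        gcongr with i hi
        exact h1 i hi
    _ = C * S * σ := by rw [← Finset.sum_mul, mul_assoc]

/-- Every tempered distribution has finite order. -/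
theorem exists_hasOrderAtMost (U : 𝓢'(Rd d, ℂ)) : ∃ N, HasOrderAtMost U N := by
  let q : Seminorm ℂ 𝓢(Rd d, ℂ) := (normSeminorm ℂ ℂ).comp U.toLinearMap
  have hq : Continuous q := continuous_norm.comp U.continuous
  obtain ⟨L, hL⟩ := exists_bound_of_tsupport_subset hq
  refine ⟨L, fun K hK => ?_⟩
  obtain ⟨C, -, hC⟩ := hL K hK
  exact ⟨C, hC⟩

/-- Since some finite bound on the order exists, the infimum is attained, and the order itself comes
with an estimate. -/
theorem exists_distOrder_eq (U : 𝓢'(Rd d, ℂ)) :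
    ∃ N : ℕ, distOrder U = N ∧ HasOrderAtMost U N := by
  classical
  have h := exists_hasOrderAtMost U
  refine ⟨Nat.find h, le_antisymm (iInf₂_le _ (Nat.find_spec h)) ?_, Nat.find_spec h⟩
  exact le_iInf₂ fun N hN => by exact_mod_cast Nat.find_min' h hN

/-! ### Cutoffs and vanishing off the support. -/

/-- A smooth cutoff function equal to `1` near `K` and supported in `O`. -/
theorem exists_cutoff {K O : Set (Rd d)} (hK : IsCompact K) (hO : IsOpen O) (hKO : K ⊆ O) :
    ∃ χ : 𝓢(Rd d, ℂ), HasCompactSupport χ ∧ tsupport χ ⊆ O ∧ (∀ᶠ x in 𝓝ˢ K, χ x = 1) ∧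
      ∀ x, ‖χ x‖ ≤ 1 := by
  obtain ⟨K', hK', hKK', hK'O⟩ := exists_compact_between hK hO hKO
  obtain ⟨f, hf1, hf0, hf⟩ := exists_contMDiffMap_one_nhds_of_subset_interior (n := ⊤)
    𝓘(ℝ, Rd d) hK.isClosed hKK'
  have hfs : ContDiff ℝ ∞ fun x => (f x : ℂ) :=
    Complex.ofRealCLM.contDiff.comp f.contMDiff.contDiff
  have hs : Function.support (fun x => (f x : ℂ)) ⊆ K' := by
    intro x hx
    by_contra h
    exact hx (by simp [hf0 x h])
  have hc : HasCompactSupport fun x => (f x : ℂ) :=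
    HasCompactSupport.intro hK' fun x hx => by simp [hf0 x hx]
  refine ⟨hc.toSchwartzMap hfs, hc, (closure_minimal hs hK'.isClosed).trans hK'O, ?_, fun x => ?_⟩
  · filter_upwards [hf1] with x hx
    simp [hx]
  · simpa [abs_of_nonneg (hf x).1] using (hf x).2

theorem smulLeftCLM_schwartz_apply (χ v : 𝓢(Rd d, ℂ)) (x : Rd d) :
    SchwartzMap.smulLeftCLM ℂ χ v x = χ x * v x := by
  rw [SchwartzMap.smulLeftCLM_apply_apply χ.hasTemperateGrowth, smul_eq_mul]

/-- Where the cutoff equals `1` on a neighbourhood of `K`, the remainder `v - χ v` is supported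
away from `K`. -/
theorem tsupport_sub_smulLeftCLM_subset {K : Set (Rd d)} {χ : 𝓢(Rd d, ℂ)}
    (hχ : ∀ᶠ x in 𝓝ˢ K, χ x = 1) (v : 𝓢(Rd d, ℂ)) :
    tsupport (v - SchwartzMap.smulLeftCLM ℂ χ v) ⊆ tsupport v \ K := by
  intro x hx
  refine ⟨?_, fun hxK => ?_⟩
  · refine closure_mono (fun y hy => ?_) hx
    contrapose! hy
    simp only [Function.mem_support, not_not] at hy ⊢
    rw [sub_apply, smulLeftCLM_schwartz_apply, hy, mul_zero, sub_zero]
  · refine notMem_tsupport_iff_eventuallyEq.2 ?_ hx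
    filter_upwards [eventually_nhdsSet_iff_forall.1 hχ x hxK] with y hy
    rw [sub_apply, smulLeftCLM_schwartz_apply, hy, one_mul, sub_self, Pi.zero_apply]

/-- A two-piece partition of unity: with `χ = 1` near the compact set `tsupport v \ O₂` and `χ`
supported in `O₁`, the function `χ v` lives in `O₁` and `v - χ v` in `O₂`. -/
theorem apply_eq_zero_of_tsupport_subset_union {U : 𝓢'(Rd d, ℂ)} {O₁ O₂ : Set (Rd d)}
    (hO₁ : IsOpen O₁) (hO₂ : IsOpen O₂)
    (h₁ : ∀ v : 𝓢(Rd d, ℂ), HasCompactSupport v → tsupport v ⊆ O₁ → U v = 0)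
    (h₂ : ∀ v : 𝓢(Rd d, ℂ), HasCompactSupport v → tsupport v ⊆ O₂ → U v = 0)
    (v : 𝓢(Rd d, ℂ)) (hv : HasCompactSupport v) (hvO : tsupport v ⊆ O₁ ∪ O₂) : U v = 0 := by
  obtain ⟨χ, hχc, hχO, hχ1, -⟩ := exists_cutoff (IsCompact.diff hv hO₂) hO₁
    (Set.sdiff_subset_iff.2 (by rwa [Set.union_comm]))
  have hs := SchwartzMap.tsupport_smulLeftCLM_subset (𝕜 := ℂ) χ v
  have hr := tsupport_sub_smulLeftCLM_subset hχ1 v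
  have e : U v = U (SchwartzMap.smulLeftCLM ℂ χ v) + U (v - SchwartzMap.smulLeftCLM ℂ χ v) := by
    rw [← map_add, add_sub_cancel]
  rw [e, h₁ _ (hv.of_isClosed_subset (isClosed_tsupport _) (hs.trans Set.inter_subset_left))
      (hs.trans (Set.inter_subset_right.trans hχO)),
    h₂ _ (hv.of_isClosed_subset (isClosed_tsupport _) (hr.trans Set.sdiff_subset)), add_zero]
  intro x hx
  have := hr hx
  by_contra h
  exact this.2 ⟨this.1, h⟩

/-- A tempered distribution vanishes on the complement of its support. -/
theorem isVanishingOn_compl_dsupport (U : 𝓢'(Rd d, ℂ)) :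
    Distribution.IsVanishingOn U (Distribution.dsupport U)ᶜ := by
  have hcpt : ∀ v : 𝓢(Rd d, ℂ), HasCompactSupport v →
      tsupport v ⊆ (Distribution.dsupport U)ᶜ → U v = 0 := by
    intro v hv hvU
    obtain ⟨O, -, hvO, hO⟩ : ∃ O : Set (Rd d), IsOpen O ∧ tsupport v ⊆ O ∧
        ∀ v : 𝓢(Rd d, ℂ), HasCompactSupport v → tsupport v ⊆ O → U v = 0 := by
      refine IsCompact.induction_on (p := fun s => ∃ O : Set (Rd d), IsOpen O ∧ s ⊆ O ∧
        ∀ v : 𝓢(Rd d, ℂ), HasCompactSupport v → tsupport v ⊆ O → U v = 0) hv ?_ ?_ ?_ ?_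
      · refine ⟨∅, isOpen_empty, subset_rfl, fun v _ h => ?_⟩
        have : v = 0 := by
          ext x
          exact image_eq_zero_of_notMem_tsupport fun hx => h hx
        rw [this, map_zero]
      · rintro s t hst ⟨O, hO, htO, h⟩
        exact ⟨O, hO, hst.trans htO, h⟩
      · rintro s t ⟨O₁, hO₁, hs, h₁⟩ ⟨O₂, hO₂, ht, h₂⟩
        exact ⟨O₁ ∪ O₂, hO₁.union hO₂, Set.union_subset_union hs ht,
          apply_eq_zero_of_tsupport_subset_union hO₁ hO₂ h₁ h₂⟩
      · intro x hx
        obtain ⟨O, hvan, hO, hxO⟩ := (Distribution.notMem_dsupport_iff x).1 (hvU hx)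
        exact ⟨O, mem_nhdsWithin_of_mem_nhds (hO.mem_nhds hxO), O, hO, subset_rfl,
          fun v _ h => hvan v h⟩
    exact hO v hv hvO
  -- Truncation does not enlarge supports, so continuity of `U` extends the compactly supported case
  -- to all Schwartz functions.
  intro v hv
  obtain ⟨u, huc, hus, -, hut⟩ := exists_truncation_tendsto v
  have h0 : ∀ k, U (u k) = 0 := fun k => hcpt _ (huc k) ((hus k).trans hv)
  have ht := (U.continuous.tendsto v).comp hut
  exact tendsto_nhds_unique ht (tendsto_const_nhds.congr fun k => (h0 k).symm)

/-! ### The transposed operator on Schwartz functions -/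

/-- The operator `φ ↦ -∂_j φ` on Schwartz functions, the transpose of `∂_j`. -/
def negDeriv (j : Fin d) : 𝓢(Rd d, ℂ) →L[ℂ] 𝓢(Rd d, ℂ) :=
  -lineDerivOpCLM ℂ 𝓢(Rd d, ℂ) (EuclideanSpace.single j (1 : ℝ))

theorem negDeriv_apply (j : Fin d) (φ : 𝓢(Rd d, ℂ)) (x : Rd d) :
    negDeriv j φ x = -fderiv ℝ φ x (EuclideanSpace.single j 1) := rfl

/-- Multiplication by `iξ_j` on Schwartz functions. -/
def mulCoord (j : Fin d) : 𝓢(Rd d, ℂ) →L[ℂ] 𝓢(Rd d, ℂ) :=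
  SchwartzMap.smulLeftCLM ℂ fun ξ : Rd d => Complex.I * (ξ j : ℂ)

theorem hasTemperateGrowth_coord (j : Fin d) :
    (fun ξ : Rd d => Complex.I * (ξ j : ℂ)).HasTemperateGrowth :=
  ((ContinuousLinearMap.mul ℝ ℂ Complex.I).comp
    (Complex.ofRealCLM.comp (EuclideanSpace.proj j : Rd d →L[ℝ] ℝ))).hasTemperateGrowth

theorem mulCoord_apply (j : Fin d) (φ : 𝓢(Rd d, ℂ)) (ξ : Rd d) :
    mulCoord j φ ξ = Complex.I * (ξ j : ℂ) * φ ξ := by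
  rw [mulCoord, SchwartzMap.smulLeftCLM_apply_apply (hasTemperateGrowth_coord j), smul_eq_mul]

/-- The product `A_{j_k}^{α_{j_k}} ⋯ A_{j_1}^{α_{j_1}}` along a list `j_1, …, j_k`. -/
def listProd (A : Fin d → 𝓢(Rd d, ℂ) →L[ℂ] 𝓢(Rd d, ℂ)) (α : Fin d →₀ ℕ) (l : List (Fin d)) :
    𝓢(Rd d, ℂ) →L[ℂ] 𝓢(Rd d, ℂ) :=
  -- New factors enter on the right because transposition reverses composition: this matches the
  -- fold in `multiDeriv` without commuting derivatives.
  l.foldr (fun j B => B * A j ^ α j) 1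

/-- The polynomial `P` evaluated at the operators `A j`. -/
def polyOp (A : Fin d → 𝓢(Rd d, ℂ) →L[ℂ] 𝓢(Rd d, ℂ)) (P : MvPolynomial (Fin d) ℂ) :
    𝓢(Rd d, ℂ) →L[ℂ] 𝓢(Rd d, ℂ) :=
  ∑ α ∈ P.support, MvPolynomial.coeff α P • listProd A α (List.finRange d)

theorem polyOp_apply (A : Fin d → 𝓢(Rd d, ℂ) →L[ℂ] 𝓢(Rd d, ℂ)) (P : MvPolynomial (Fin d) ℂ)
    (φ : 𝓢(Rd d, ℂ)) (x : Rd d) : polyOp A P φ x =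
      ∑ α ∈ P.support, MvPolynomial.coeff α P * listProd A α (List.finRange d) φ x := by
  simp [polyOp, sum_apply]

theorem angularFourier_mulCoord (j : Fin d) (φ : 𝓢(Rd d, ℂ)) :
    angularFourier d (mulCoord j φ) = negDeriv j (angularFourier d φ) := by
  let e : Rd d := EuclideanSpace.single j 1
  have hg : (inner ℝ · (dilation d e)).HasTemperateGrowth := by fun_prop
  have h : ∀ ψ, angularFourier d ψ = (((2 * Real.pi) ^ (-(d : ℝ) / 2) : ℝ) : ℂ) •
    SchwartzMap.compCLMOfContinuousLinearEquiv ℂ (dilation d) (𝓕 ψ) := fun _ => rfl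
  -- The chain rule for the dilation replaces the direction `e` by `(2π)⁻¹ e`, which cancels the
  -- `2π` in the derivative of the transform `∫ e^{-2πi ξ·x} φ(x) dx`.
  have h2 : mulCoord j φ = -(-(2 * Real.pi * Complex.I) •
      SchwartzMap.smulLeftCLM ℂ (inner ℝ · (dilation d e)) φ) := by
    ext ξ
    have hi : inner ℝ ξ (dilation d e) = (2 * Real.pi)⁻¹ * ξ j := by
      change inner ℝ ξ ((2 * Real.pi)⁻¹ • e) = _
      rw [inner_smul_right]
      simp [e, EuclideanSpace.inner_single_right]
    have hpi : (Real.pi : ℂ) ≠ 0 := by exact_mod_cast Real.pi_ne_zero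
    rw [mulCoord_apply, neg_apply, smul_apply, SchwartzMap.smulLeftCLM_apply_apply hg, hi,
      Complex.real_smul, smul_eq_mul]
    push_cast
    field_simp
  change _ = -(∂_{e} (angularFourier d φ))
  rw [h2, map_neg, h, h, lineDerivOp_smul, SchwartzMap.lineDerivOp_compCLMOfContinuousLinearEquiv,
    SchwartzMap.lineDerivOp_fourier_eq]

theorem angularFourier_polyOp (P : MvPolynomial (Fin d) ℂ) (φ : 𝓢(Rd d, ℂ)) :
    angularFourier d (polyOp mulCoord P φ) = polyOp negDeriv P (angularFourier d φ) := by
  have h1 : ∀ (j : Fin d) (n : ℕ) (φ : 𝓢(Rd d, ℂ)),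
      angularFourier d ((mulCoord j ^ n) φ) = (negDeriv j ^ n) (angularFourier d φ) := by
    intro j n
    induction n with
    | zero => intro φ; rfl
    | succ n ih =>
      intro φ
      rw [pow_succ, pow_succ, mul_apply_eq_comp, ih, angularFourier_mulCoord]
      rfl
  have h2 : ∀ (α : Fin d →₀ ℕ) (l : List (Fin d)) (φ : 𝓢(Rd d, ℂ)),
      angularFourier d (listProd mulCoord α l φ) = listProd negDeriv α l (angularFourier d φ) := by
    intro α l
    induction l with
    | nil => intro φ; rfl
    | cons j l ih =>
      intro φ
      change angularFourier d (listProd mulCoord α l ((mulCoord j ^ α j) φ)) =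
        listProd negDeriv α l ((negDeriv j ^ α j) (angularFourier d φ))
      rw [ih, h1]
  simp only [polyOp, FunLike.coe_sum, Finset.sum_apply, FunLike.coe_smul, Pi.smul_apply,
    map_sum, map_smul, h2]

theorem polyOp_mulCoord_apply (P : MvPolynomial (Fin d) ℂ) (φ : 𝓢(Rd d, ℂ)) (ξ : Rd d) :
    polyOp mulCoord P φ ξ = evalI P ξ * φ ξ := by
  have h1 : ∀ (j : Fin d) (n : ℕ) (φ : 𝓢(Rd d, ℂ)),
      (mulCoord j ^ n) φ ξ = (Complex.I * (ξ j : ℂ)) ^ n * φ ξ := by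
    intro j n
    induction n with
    | zero => intro φ; simp
    | succ n ih =>
      intro φ
      rw [pow_succ, mul_apply_eq_comp, ih, mulCoord_apply, pow_succ]
      ring
  have h2 : ∀ (α : Fin d →₀ ℕ) (l : List (Fin d)) (φ : 𝓢(Rd d, ℂ)),
      listProd mulCoord α l φ ξ =
        (l.map fun j => (Complex.I * (ξ j : ℂ)) ^ α j).prod * φ ξ := by
    intro α l
    induction l with
    | nil => intro φ; simp [listProd]
    | cons j l ih =>
      intro φ
      change listProd mulCoord α l ((mulCoord j ^ α j) φ) ξ = _
      rw [ih, h1, List.map_cons, List.prod_cons]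
      ring
  rw [polyOp_apply, evalI, MvPolynomial.eval_eq', Finset.sum_mul]
  refine Finset.sum_congr rfl fun α _ => ?_
  rw [h2, ← mul_assoc, ← List.prod_ofFn, List.ofFn_eq_map]

theorem polyOp_mulCoord_pow_apply (P : MvPolynomial (Fin d) ℂ) (n : ℕ) (φ : 𝓢(Rd d, ℂ))
    (ξ : Rd d) : (polyOp mulCoord P ^ n) φ ξ = evalI P ξ ^ n * φ ξ := by
  induction n generalizing φ with
  | zero => simp
  | succ n ih =>
    rw [pow_succ, mul_apply_eq_comp, ih, polyOp_mulCoord_apply, pow_succ, mul_assoc]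

theorem angularFourier_polyOp_pow (P : MvPolynomial (Fin d) ℂ) (n : ℕ) (φ : 𝓢(Rd d, ℂ)) :
    angularFourier d ((polyOp mulCoord P ^ n) φ) =
      (polyOp negDeriv P ^ n) (angularFourier d φ) := by
  induction n generalizing φ with
  | zero => rfl
  | succ n ih =>
    rw [pow_succ, pow_succ, mul_apply_eq_comp, ih, angularFourier_polyOp]
    rfl

theorem contDiff_evalI (P : MvPolynomial (Fin d) ℂ) : ContDiff ℝ ∞ (evalI P) := by
  have : evalI P = fun ξ : Rd d => ∑ α ∈ P.support,
      MvPolynomial.coeff α P * ∏ j, (Complex.I * (ξ j : ℂ)) ^ α j := by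
    ext ξ
    rw [evalI, MvPolynomial.eval_eq']
  rw [this]
  exact ContDiff.sum fun α _ => contDiff_const.mul
    (contDiff_prod fun j _ => (hasTemperateGrowth_coord j).1.pow _)

/-! ### Integration by parts -/

theorem contDiff_partialDeriv {g : Rd d → ℂ} (hg : ContDiff ℝ ∞ g) (j : Fin d) :
    ContDiff ℝ ∞ (partialDeriv j g) :=
  (hg.fderiv_right (m := ∞) (by simp)).clm_apply contDiff_const

theorem contDiff_partialDeriv_iterate {g : Rd d → ℂ} (hg : ContDiff ℝ ∞ g) (j : Fin d) (n : ℕ) :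
    ContDiff ℝ ∞ ((partialDeriv j)^[n] g) := by
  induction n with
  | zero => exact hg
  | succ n ih => rw [Function.iterate_succ_apply']; exact contDiff_partialDeriv ih j

theorem contDiff_foldr_partialDeriv {g : Rd d → ℂ} (hg : ContDiff ℝ ∞ g) (α : Fin d →₀ ℕ)
    (l : List (Fin d)) :
    ContDiff ℝ ∞ (l.foldr (fun j h => (partialDeriv j)^[α j] h) g) := by
  induction l with
  | nil => exact hg
  | cons j l ih => exact contDiff_partialDeriv_iterate ih j _

theorem contDiff_polyDeriv {g : Rd d → ℂ} (hg : ContDiff ℝ ∞ g) (P : MvPolynomial (Fin d) ℂ) :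
    ContDiff ℝ ∞ (polyDeriv P g) :=
  ContDiff.sum fun α _ => contDiff_const.mul (contDiff_foldr_partialDeriv hg α _)

theorem contDiff_polyDeriv_iterate {g : Rd d → ℂ} (hg : ContDiff ℝ ∞ g)
    (P : MvPolynomial (Fin d) ℂ) (n : ℕ) : ContDiff ℝ ∞ ((polyDeriv P)^[n] g) := by
  induction n with
  | zero => exact hg
  | succ n ih => rw [Function.iterate_succ_apply']; exact contDiff_polyDeriv ih P

theorem integrable_mul_of_hasCompactSupport {g : Rd d → ℂ} (hg : Continuous g)
    {φ : Rd d → ℂ} (hφ : Continuous φ) (hc : HasCompactSupport φ) :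
    Integrable fun x => g x * φ x :=
  (hg.mul hφ).integrable_of_hasCompactSupport hc.mul_left

theorem tsupport_negDeriv_subset (j : Fin d) (φ : 𝓢(Rd d, ℂ)) :
    tsupport (negDeriv j φ) ⊆ tsupport φ := by
  have : ⇑(negDeriv j φ) = -fun x => fderiv ℝ φ x (EuclideanSpace.single j 1) := rfl
  rw [this, tsupport_neg]
  exact tsupport_fderiv_apply_subset ℝ _

theorem integral_partialDeriv_mul {g : Rd d → ℂ} (hg : ContDiff ℝ ∞ g) (j : Fin d)
    {φ : 𝓢(Rd d, ℂ)} (hφ : HasCompactSupport φ) :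
    ∫ x, partialDeriv j g x * φ x = ∫ x, g x * negDeriv j φ x := by
  have hc : HasCompactSupport fun x => fderiv ℝ φ x (EuclideanSpace.single j 1) :=
    hφ.of_isClosed_subset (isClosed_tsupport _) (tsupport_fderiv_apply_subset ℝ _)
  have h := integral_mul_fderiv_eq_neg_fderiv_mul_of_integrable (μ := volume)
    (f := g) (g := φ) (v := EuclideanSpace.single j (1 : ℝ))
    (integrable_mul_of_hasCompactSupport (contDiff_partialDeriv hg j).continuous φ.continuous hφ)
    (integrable_mul_of_hasCompactSupport hg.continuous
      (contDiff_partialDeriv (φ.smooth ⊤) j).continuous hc)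
    (integrable_mul_of_hasCompactSupport hg.continuous φ.continuous hφ)
    (fun x _ => hg.differentiable (by simp) x) (fun x _ => φ.differentiable x)
  simp only [negDeriv_apply, mul_neg, integral_neg]
  rw [h, neg_neg]
  rfl

/-- `∫ (P(∂) g) φ = ∫ g (P(-∂) φ)` for smooth `g` and `φ` smooth with compact support. -/
theorem integral_polyDeriv_mul {g : Rd d → ℂ} (hg : ContDiff ℝ ∞ g) (P : MvPolynomial (Fin d) ℂ)
    {φ : 𝓢(Rd d, ℂ)} (hφ : HasCompactSupport φ) :
    HasCompactSupport (polyOp negDeriv P φ) ∧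
      ∫ x, polyDeriv P g x * φ x = ∫ x, g x * polyOp negDeriv P φ x := by
  have h1 : ∀ (j : Fin d) (n : ℕ) {g : Rd d → ℂ} (_ : ContDiff ℝ ∞ g) {φ : 𝓢(Rd d, ℂ)}
      (_ : HasCompactSupport φ), HasCompactSupport ((negDeriv j ^ n) φ) ∧
        ∫ x, (partialDeriv j)^[n] g x * φ x = ∫ x, g x * (negDeriv j ^ n) φ x := by
    intro j n g hg
    induction n with
    | zero => intro φ hφ; exact ⟨hφ, rfl⟩
    | succ n ih =>
      intro φ hφ
      have hφ' : HasCompactSupport (negDeriv j φ) :=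
        hφ.of_isClosed_subset (isClosed_tsupport _) (tsupport_negDeriv_subset j φ)
      rw [pow_succ, mul_apply_eq_comp]
      refine ⟨(ih hφ').1, ?_⟩
      rw [Function.iterate_succ_apply',
        integral_partialDeriv_mul (contDiff_partialDeriv_iterate hg j n) j hφ, (ih hφ').2]
  have h2 : ∀ (α : Fin d →₀ ℕ) (l : List (Fin d)) {φ : 𝓢(Rd d, ℂ)} (_ : HasCompactSupport φ),
      HasCompactSupport (listProd negDeriv α l φ) ∧
        ∫ x, l.foldr (fun j h => (partialDeriv j)^[α j] h) g x * φ x =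
          ∫ x, g x * listProd negDeriv α l φ x := by
    intro α l
    induction l with
    | nil => intro φ hφ; exact ⟨hφ, rfl⟩
    | cons j l ih =>
      intro φ hφ
      obtain ⟨h3, h4⟩ := h1 j (α j) (contDiff_foldr_partialDeriv hg α l) hφ
      exact ⟨(ih h3).1, h4.trans (ih h3).2⟩
  constructor
  · have hP : ⇑(polyOp negDeriv P φ) = fun x => ∑ α ∈ P.support,
        MvPolynomial.coeff α P * listProd negDeriv α (List.finRange d) φ x :=
      funext fun x => polyOp_apply _ P φ x
    rw [hP, ← Finset.sum_fn]
    exact Finset.sum_induction _ (fun g : Rd d → ℂ => HasCompactSupport g)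
      (fun _ _ => HasCompactSupport.add) HasCompactSupport.zero
      fun α _ => (h2 α _ hφ).1.mul_left
  · simp only [polyDeriv, polyOp_apply, Finset.sum_mul, Finset.mul_sum]
    rw [integral_finsetSum, integral_finsetSum]
    · refine Finset.sum_congr rfl fun α _ => ?_
      have := (h2 α (List.finRange d) hφ).2
      simp only [mul_assoc, mul_left_comm _ (MvPolynomial.coeff α P), integral_const_mul]
      rw [← this]
      rfl
    · intro α _
      exact integrable_mul_of_hasCompactSupport hg.continuous
        (continuous_const.mul (SchwartzMap.continuous _)) (h2 α _ hφ).1.mul_left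
    · intro α _
      exact integrable_mul_of_hasCompactSupport
        (continuous_const.mul (contDiff_foldr_partialDeriv hg α _).continuous) φ.continuous hφ

theorem integral_polyDeriv_iterate_mul {g : Rd d → ℂ} (hg : ContDiff ℝ ∞ g)
    (P : MvPolynomial (Fin d) ℂ) (n : ℕ) {φ : 𝓢(Rd d, ℂ)} (hφ : HasCompactSupport φ) :
    HasCompactSupport ((polyOp negDeriv P ^ n) φ) ∧
      ∫ x, (polyDeriv P)^[n] g x * φ x = ∫ x, g x * (polyOp negDeriv P ^ n) φ x := by
  induction n generalizing φ with
  | zero => exact ⟨hφ, rfl⟩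
  | succ n ih =>
    obtain ⟨h1, h2⟩ := integral_polyDeriv_mul (contDiff_polyDeriv_iterate hg P n) P hφ
    rw [pow_succ, mul_apply_eq_comp]
    exact ⟨(ih h1).1, by rw [Function.iterate_succ_apply', h2, (ih h1).2]⟩

theorem Represents.apply_polyOp_pow {f : Rd d → ℂ} (hf : ContDiff ℝ ∞ f) {T : 𝓢'(Rd d, ℂ)}
    (hT : Represents f T) (P : MvPolynomial (Fin d) ℂ) (n : ℕ) {φ : 𝓢(Rd d, ℂ)}
    (hφ : HasCompactSupport φ) :
    T ((polyOp negDeriv P ^ n) φ) = ∫ x, (polyDeriv P)^[n] f x * φ x := by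
  obtain ⟨h1, h2⟩ := integral_polyDeriv_iterate_mul hf P n hφ
  rw [h2, hT _ h1]

/-! ### Growth estimates imply support conditions -/

theorem integrable_one_add_norm_pow_mul (N : ℕ) (φ : 𝓢(Rd d, ℂ)) :
    Integrable fun x => (1 + ‖x‖) ^ N * ‖φ x‖ := by
  have : (fun x => (1 + ‖x‖) ^ N * ‖φ x‖) = fun x => ∑ k ∈ Finset.range (N + 1),
      (N.choose k : ℝ) * (‖x‖ ^ k * ‖φ x‖) := by
    ext x
    rw [add_comm, add_pow, Finset.sum_mul]
    exact Finset.sum_congr rfl fun k _ => by rw [one_pow]; ring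
  rw [this]
  exact integrable_finsetSum _ fun k _ => (φ.integrable_pow_mul volume k).const_mul _

/-- Schwartz decay beats the weight: `r` is chosen so that `(1 + ‖x‖) ^ (-r)` is integrable, and
finitely many sup-seminorms then bound the weighted `L¹` norm. -/
theorem exists_seminorm_integral_le (d N : ℕ) :
    ∃ (D : ℝ) (q : Seminorm ℂ 𝓢(Rd d, ℂ)), 0 ≤ D ∧ Continuous q ∧
      ∀ φ, ∫ x, (1 + ‖x‖) ^ N * ‖φ x‖ ≤ D * q φ := by
  let r := (volume : Measure (Rd d)).integrablePower
  let J : ℝ := 2 ^ r * ∫ x : Rd d, (1 + ‖x‖) ^ (-(r : ℝ))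
  let p : ℕ → Seminorm ℂ 𝓢(Rd d, ℂ) := fun k => SchwartzMap.seminorm ℂ k 0
  have hp : ∀ k, Continuous (p k) := fun k =>
    (schwartz_withSeminorms ℂ (Rd d) ℂ).continuous_seminorm (k, 0)
  have hJ : 0 ≤ J := mul_nonneg (by positivity) (integral_nonneg fun x => by positivity)
  refine ⟨2 ^ (N - 1) * J, (p 0 + p (0 + r)) + (p 0 + p (N + r)), by positivity,
    ((hp _).add (hp _)).add ((hp _).add (hp _)), fun φ => ?_⟩
  have h1 : ∀ k, ∫ x, ‖x‖ ^ k * ‖φ x‖ ≤ J * (p 0 φ + p (k + r) φ) := by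
    intro k
    have := integral_pow_mul_iteratedFDeriv_le ℂ volume φ k 0
    simpa only [norm_iteratedFDeriv_zero] using this
  calc ∫ x, (1 + ‖x‖) ^ N * ‖φ x‖
      ≤ ∫ x, 2 ^ (N - 1) * (‖x‖ ^ 0 * ‖φ x‖ + ‖x‖ ^ N * ‖φ x‖) := by
        refine integral_mono (integrable_one_add_norm_pow_mul N φ)
          (((φ.integrable_pow_mul volume 0).add (φ.integrable_pow_mul volume N)).const_mul _)
          fun x => ?_
        have := add_pow_le zero_le_one (norm_nonneg x) N
        rw [one_pow] at this
        calc (1 + ‖x‖) ^ N * ‖φ x‖ ≤ 2 ^ (N - 1) * (1 + ‖x‖ ^ N) * ‖φ x‖ := by gcongr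
          _ = _ := by ring
    _ = 2 ^ (N - 1) * (∫ x, ‖x‖ ^ 0 * ‖φ x‖) + 2 ^ (N - 1) * ∫ x, ‖x‖ ^ N * ‖φ x‖ := by
        rw [integral_const_mul, integral_add (φ.integrable_pow_mul volume 0)
          (φ.integrable_pow_mul volume N), mul_add]
    _ ≤ 2 ^ (N - 1) * (J * (p 0 φ + p (0 + r) φ)) +
          2 ^ (N - 1) * (J * (p 0 φ + p (N + r) φ)) := by
        gcongr
        · exact h1 0
        · exact h1 N
    _ = _ := by
        change _ = _ * ((p 0 φ + p (0 + r) φ) + (p 0 φ + p (N + r) φ))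
        ring

/-- If `P(∂)^n f` is polynomially bounded, then it represents `P(∂)^n T` on all
Schwartz functions. -/
theorem Represents.apply_polyOp_pow_of_bound {f : Rd d → ℂ} (hf : ContDiff ℝ ∞ f)
    {T : 𝓢'(Rd d, ℂ)} (hT : Represents f T) (P : MvPolynomial (Fin d) ℂ) (n : ℕ) {N : ℕ} {A : ℝ}
    (hA : ∀ x, ‖(polyDeriv P)^[n] f x‖ ≤ A * (1 + ‖x‖) ^ N) (φ : 𝓢(Rd d, ℂ)) :
    T ((polyOp negDeriv P ^ n) φ) = ∫ x, (polyDeriv P)^[n] f x * φ x := by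
  obtain ⟨u, huc, -, hub, hut⟩ := exists_truncation_tendsto φ
  have hg := (contDiff_polyDeriv_iterate hf P n).continuous
  have h1 : Tendsto (fun k => T ((polyOp negDeriv P ^ n) (u k))) atTop
      (𝓝 (T ((polyOp negDeriv P ^ n) φ))) :=
    ((T.continuous.comp (polyOp negDeriv P ^ n).continuous).tendsto φ).comp hut
  have h2 : Tendsto (fun k => ∫ x, (polyDeriv P)^[n] f x * u k x) atTop
      (𝓝 (∫ x, (polyDeriv P)^[n] f x * φ x)) := by
    refine tendsto_integral_of_dominated_convergence (fun x => A * ((1 + ‖x‖) ^ N * ‖φ x‖))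
      (fun k => (hg.mul (u k).continuous).aestronglyMeasurable)
      ((integrable_one_add_norm_pow_mul N φ).const_mul A) (fun k => ?_) ?_
    · refine Eventually.of_forall fun x => ?_
      rw [norm_mul, ← mul_assoc]
      exact mul_le_mul (hA x) (hub k x) (norm_nonneg _) ((norm_nonneg _).trans (hA x))
    · refine Eventually.of_forall fun x => Tendsto.const_mul _ ?_
      have := ((SchwartzMap.toBoundedContinuousFunctionCLM ℂ (Rd d) ℂ).continuous.tendsto φ).comp
        hut
      exact ((BoundedContinuousFunction.evalCLM ℂ x).continuous.tendsto _).comp this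
  refine tendsto_nhds_unique h1 (h2.congr fun k => ?_)
  rw [hT.apply_polyOp_pow hf P n (huc k)]

/-- Near a point where `|P(iξ)| > ρ`, division by `P(iξ)` is given by a smooth function bounded by
`ρ⁻¹`. -/
theorem exists_local_inverse (P : MvPolynomial (Fin d) ℂ) {ρ : ℝ} (hρ : 0 < ρ) {ξ₀ : Rd d}
    (hξ₀ : ρ < ‖evalI P ξ₀‖) :
    ∃ (g : Rd d → ℂ) (r : ℝ), 0 < r ∧ ContDiff ℝ ∞ g ∧ (∀ ξ, ‖g ξ‖ ≤ ρ⁻¹) ∧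
      ∀ ξ ∈ Metric.closedBall ξ₀ r, evalI P ξ * g ξ = 1 := by
  have hP := contDiff_evalI P
  have hO : IsOpen {ξ : Rd d | ρ < ‖evalI P ξ‖} := isOpen_lt continuous_const hP.continuous.norm
  obtain ⟨r, hr, hrO⟩ := Metric.nhds_basis_closedBall.mem_iff.1 (hO.mem_nhds hξ₀)
  obtain ⟨θ, -, hθO, hθ1, hθn⟩ := exists_cutoff (isCompact_closedBall ξ₀ r) hO hrO
  have hne : ∀ ξ, ρ < ‖evalI P ξ‖ → evalI P ξ ≠ 0 := fun ξ h => norm_pos_iff.1 (hρ.trans h)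
  -- The cutoff `θ` is supported where `|P(iξ)| > ρ`, so the quotient is smooth and bounded
  -- everywhere, zeros of `P` included, and it inverts `P` on the ball where `θ = 1`.
  refine ⟨fun ξ => θ ξ / evalI P ξ, r, hr, ?_, fun ξ => ?_, fun ξ hξ => ?_⟩
  · refine contDiff_iff_contDiffAt.2 fun ξ => ?_
    by_cases hξ : ξ ∈ tsupport θ
    · simp_rw [div_eq_mul_inv]
      exact (θ.smooth ⊤).contDiffAt.mul (hP.contDiffAt.inv (hne ξ (hθO hξ)))
    · refine contDiffAt_const (c := (0 : ℂ)) |>.congr_of_eventuallyEq ?_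
      filter_upwards [notMem_tsupport_iff_eventuallyEq.1 hξ] with y hy
      rw [hy, Pi.zero_apply, zero_div]
  · change ‖θ ξ / evalI P ξ‖ ≤ ρ⁻¹
    by_cases hξ : ξ ∈ tsupport θ
    · rw [norm_div, div_eq_mul_inv]
      have h1 : ρ < ‖evalI P ξ‖ := hθO hξ
      calc _ ≤ 1 * ρ⁻¹ := by
            gcongr
            exact hθn ξ
        _ = ρ⁻¹ := one_mul _
    · rw [image_eq_zero_of_notMem_tsupport hξ, zero_div, norm_zero]
      positivity
  · change evalI P ξ * (θ ξ / evalI P ξ) = 1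
    rw [eventually_nhdsSet_iff_forall.1 hθ1 ξ hξ |>.self_of_nhds, mul_one_div_cancel
      (hne ξ (hrO hξ))]

theorem tendsto_pow_mul_pow_mul_pow {R ρ : ℝ} (hR : 0 ≤ R) (hRρ : R < ρ) (N L : ℕ) :
    Tendsto (fun n : ℕ => (n : ℝ) ^ N * R ^ n * (((n : ℝ) + 1) ^ L * ρ⁻¹ ^ n)) atTop (𝓝 0) := by
  have hρ : 0 < ρ := hR.trans_lt hRρ
  have h := (tendsto_pow_const_mul_const_pow_of_abs_lt_one (N + L) (r := R * ρ⁻¹) (by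
    rw [abs_of_nonneg (by positivity), ← div_eq_mul_inv, div_lt_one hρ]
    exact hRρ)).const_mul ((2 : ℝ) ^ L)
  rw [mul_zero] at h
  refine squeeze_zero' (Eventually.of_forall fun n => by positivity) ?_ h
  filter_upwards [eventually_ge_atTop 1] with n hn
  have hn' : (1 : ℝ) ≤ n := by exact_mod_cast hn
  calc _ ≤ (n : ℝ) ^ N * R ^ n * ((2 * (n : ℝ)) ^ L * ρ⁻¹ ^ n) := by
        gcongr
        linarith
    _ = _ := by
        rw [mul_pow, mul_pow, pow_add]
        ring

theorem dsupport_subset_of_growthBound {f : Rd d → ℂ} (hf : ContDiff ℝ ∞ f) {T : 𝓢'(Rd d, ℂ)}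
    (hT : Represents f T) (P : MvPolynomial (Fin d) ℂ) {N : ℕ} {C R : ℝ} (hR : 0 ≤ R)
    (h : GrowthBound P f N C R) :
    Distribution.dsupport (distFourier T) ⊆ {ξ | ‖evalI P ξ‖ ≤ R} := by
  intro ξ₀ hξ₀
  by_contra hlt
  rw [Set.mem_ofPred_eq, not_le] at hlt
  obtain ⟨ρ, hRρ, hρξ⟩ := exists_between hlt
  have hρ : 0 < ρ := hR.trans_lt hRρ
  obtain ⟨g, r, hr, hg, hgρ, hPg⟩ := exists_local_inverse P hρ hρξ
  refine (Distribution.notMem_dsupport_iff ξ₀).2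
    ⟨Metric.ball ξ₀ r, fun ψ hψ => ?_, Metric.isOpen_ball, Metric.mem_ball_self hr⟩ hξ₀
  have hψK : tsupport ψ ⊆ Metric.closedBall ξ₀ r := hψ.trans Metric.ball_subset_closedBall
  have hψc : HasCompactSupport ψ :=
    (isCompact_closedBall ξ₀ r).of_isClosed_subset (isClosed_tsupport _) hψK
  have hex : ∀ n : ℕ, ∃ u : 𝓢(Rd d, ℂ), ⇑u = fun ξ => g ξ ^ n • ψ ξ := by
    intro n
    have h1 : HasCompactSupport fun ξ => g ξ ^ n • ψ ξ := by
      refine hψc.mono fun x hx => ?_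
      contrapose! hx
      simp only [Function.mem_support, not_not] at hx ⊢
      rw [hx, smul_zero]
    have h2 : ContDiff ℝ ∞ fun ξ => g ξ ^ n • ψ ξ := (hg.pow n).smul (ψ.smooth ⊤)
    exact ⟨h1.toSchwartzMap h2, rfl⟩
  choose u hu using hex
  have hu' : ∀ n ξ, u n ξ = g ξ ^ n * ψ ξ := fun n ξ => congrFun (hu n) ξ
  have huK : ∀ n, tsupport (u n) ⊆ Metric.closedBall ξ₀ r := fun n => by
    refine (closure_mono fun x hx => ?_).trans hψK
    contrapose! hx
    simp only [Function.mem_support, not_not] at hx ⊢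
    rw [hu', hx, mul_zero]
  have hMu : ∀ n, (polyOp mulCoord P ^ n) (u n) = ψ := by
    intro n
    ext ξ
    rw [polyOp_mulCoord_pow_apply, hu', ← mul_assoc, ← mul_pow]
    by_cases hξ : ξ ∈ tsupport ψ
    · rw [hPg ξ (hψK hξ), one_pow, one_mul]
    · rw [image_eq_zero_of_notMem_tsupport hξ, mul_zero]
  obtain ⟨D, q, hD, hq, hDq⟩ := exists_seminorm_integral_le d N
  -- All the `u n` are supported in one ball, so a single `L` and a single `B` serve every `n`.
  obtain ⟨L, hL⟩ := exists_bound_of_tsupport_subset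
    (q := q.comp (angularFourier d).toLinearMap) (hq.comp (angularFourier d).continuous)
  obtain ⟨B, hB, hBL⟩ := hL _ (isCompact_closedBall ξ₀ r)
  choose G hG hGb using fun l : ℕ => exists_bound_iteratedFDeriv_pow_smul hg
    (inv_pos.2 hρ) l (ψ.smooth ⊤) hψc (fun x _ => hgρ x)
  let S : ℝ := ∑ k ∈ Finset.range (L + 1), G k
  have hsem : ∀ n, ∑ k ∈ Finset.range (L + 1), SchwartzMap.seminorm ℂ 0 k (u n) ≤
      S * (((n : ℝ) + 1) ^ L * ρ⁻¹ ^ n) := by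
    intro n
    rw [Finset.sum_mul]
    refine Finset.sum_le_sum fun k hk => ?_
    have hGk := hG k
    refine SchwartzMap.seminorm_le_bound ℂ 0 k _ (by positivity) fun x => ?_
    rw [pow_zero, one_mul, hu]
    refine (hGb k n x).trans ?_
    rw [← mul_assoc]
    gcongr
    · simp
    · exact Nat.lt_succ_iff.1 (Finset.mem_range.1 hk)
  have hest : ∀ n : ℕ, 1 ≤ n → ‖distFourier T ψ‖ ≤
      |C| * D * B * S * ((n : ℝ) ^ N * R ^ n * (((n : ℝ) + 1) ^ L * ρ⁻¹ ^ n)) := by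
    intro n hn
    have hA : ∀ x, ‖(polyDeriv P)^[n] f x‖ ≤ (|C| * (n : ℝ) ^ N * R ^ n) * (1 + ‖x‖) ^ N := by
      intro x
      refine (h n hn x).trans ?_
      gcongr
      exact le_abs_self C
    -- `𝓕(u n)` is Schwartz but need not have compact support; the growth bound is what allows `T`
    -- to be paired with it through an integral.
    have e1 : distFourier T ψ = ∫ x, (polyDeriv P)^[n] f x * angularFourier d (u n) x := by
      rw [← hT.apply_polyOp_pow_of_bound hf P n hA, ← angularFourier_polyOp_pow, hMu]
      rfl
    calc ‖distFourier T ψ‖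
        ≤ ∫ x, (|C| * (n : ℝ) ^ N * R ^ n) * ((1 + ‖x‖) ^ N * ‖angularFourier d (u n) x‖) := by
          rw [e1]
          refine norm_integral_le_of_norm_le
            ((integrable_one_add_norm_pow_mul N _).const_mul _) (Eventually.of_forall fun x => ?_)
          rw [norm_mul, ← mul_assoc]
          gcongr
          exact hA x
      _ ≤ (|C| * (n : ℝ) ^ N * R ^ n) * (D * (B * (S * (((n : ℝ) + 1) ^ L * ρ⁻¹ ^ n)))) := by
          rw [integral_const_mul]
          gcongr
          refine (hDq _).trans ?_
          gcongr
          refine (hBL (u n) (huK n)).trans ?_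
          gcongr
          exact hsem n
      _ = _ := by ring
  have hlim := (tendsto_pow_mul_pow_mul_pow hR hRρ N L).const_mul (|C| * D * B * S)
  rw [mul_zero] at hlim
  refine norm_le_zero_iff.1 (ge_of_tendsto hlim ?_)
  filter_upwards [eventually_ge_atTop 1] with n hn using hest n hn

/-! ### Support conditions imply growth estimates -/

/-- Differentiation under the integral sign brings down powers of `v`, so derivatives are bounded by
moments of `h`, with no derivative of `h` involved. -/
theorem norm_iteratedFDeriv_fourierInv_le (h : 𝓢(Rd d, ℂ)) (k : ℕ) (ξ : Rd d) :
    ‖iteratedFDeriv ℝ k (𝓕⁻ h : 𝓢(Rd d, ℂ)) ξ‖ ≤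
      (2 * Real.pi) ^ k * ∑ p ∈ Finset.range (k + 1), ∫ v, ‖v‖ ^ p * ‖h v‖ := by
  have e : ⇑(𝓕⁻ h : 𝓢(Rd d, ℂ)) = (𝓕 (h : Rd d → ℂ)) ∘ LinearIsometryEquiv.neg ℝ (E := Rd d) := by
    ext y
    rw [SchwartzMap.fourierInv_coe, Real.fourierInv_eq_fourier_neg]
    rfl
  rw [e, LinearIsometryEquiv.norm_iteratedFDeriv_comp_right]
  have := Real.pow_mul_norm_iteratedFDeriv_fourier_le (K := ⊤) (N := ⊤) (k := k) (n := 0)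
    (h.smooth ⊤) (fun k n _ _ => h.integrable_pow_mul_iteratedFDeriv volume k n) le_top le_top
    (LinearIsometryEquiv.neg ℝ (E := Rd d) ξ)
  simpa [Finset.sum_product] using this

theorem integral_norm_comp_dilation_symm (φ : 𝓢(Rd d, ℂ)) :
    ∫ v, ‖φ ((dilation d).symm v)‖ = ((2 * Real.pi) ^ d)⁻¹ * ∫ v, ‖φ v‖ := by
  have hs : ∀ v, (dilation d).symm v = (2 * Real.pi) • v := by
    intro v
    rw [ContinuousLinearEquiv.symm_apply_eq]
    change v = (2 * Real.pi)⁻¹ • (2 * Real.pi) • v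
    rw [inv_smul_smul₀ (by positivity)]
  simp_rw [hs]
  rw [Measure.integral_comp_smul volume (fun v => ‖φ v‖), finrank_euclideanSpace_fin,
    abs_of_nonneg (by positivity), smul_eq_mul]

/-- A function of mass at most one supported in the unit ball around `x` is the Fourier transform
of a function whose `k`-th derivatives are `O((1 + ‖x‖) ^ k)`. -/
theorem exists_angularFourier_eq (d : ℕ) :
    ∃ E : ℕ → ℝ, (∀ k, 0 ≤ E k) ∧ ∀ (x : Rd d) (φ : 𝓢(Rd d, ℂ)),
      tsupport φ ⊆ Metric.closedBall x 1 → ∫ y, ‖φ y‖ ≤ 1 →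
      ∃ w : 𝓢(Rd d, ℂ), angularFourier d w = φ ∧
        ∀ k ξ, ‖iteratedFDeriv ℝ k w ξ‖ ≤ E k * (1 + ‖x‖) ^ k := by
  let c : ℂ := (((2 * Real.pi) ^ (-(d : ℝ) / 2) : ℝ) : ℂ)
  have hc : c ≠ 0 := Complex.ofReal_ne_zero.2 (by positivity)
  -- `J` is the Jacobian factor of the rescaling between the two normalizations. Only the mass and
  -- the location of `φ` enter the bounds, so `E` is independent of `x` and `φ`.
  let J : ℝ := ((2 * Real.pi) ^ d)⁻¹
  have hJ : 0 ≤ J := by positivity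
  refine ⟨fun k => ‖c⁻¹‖ * ((2 * Real.pi) ^ k * ∑ p ∈ Finset.range (k + 1), J),
    fun k => by positivity, fun x φ hφ h1 => ?_⟩
  let h : 𝓢(Rd d, ℂ) := SchwartzMap.compCLMOfContinuousLinearEquiv ℂ (dilation d).symm φ
  have hh : ∀ v, h v = φ ((dilation d).symm v) := fun _ => rfl
  refine ⟨c⁻¹ • 𝓕⁻ h, ?_, fun k ξ => ?_⟩
  · rw [map_smul]
    change c⁻¹ • c • SchwartzMap.compCLMOfContinuousLinearEquiv ℂ (dilation d) (𝓕 (𝓕⁻ h)) = φ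
    rw [inv_smul_smul₀ hc, FourierTransform.fourier_fourierInv_eq]
    ext y
    change φ ((dilation d).symm (dilation d y)) = φ y
    rw [ContinuousLinearEquiv.symm_apply_apply]
  · have e : iteratedFDeriv ℝ k (c⁻¹ • 𝓕⁻ h : 𝓢(Rd d, ℂ)) ξ =
        c⁻¹ • iteratedFDeriv ℝ k (𝓕⁻ h : 𝓢(Rd d, ℂ)) ξ :=
      iteratedFDeriv_const_smul_apply (((𝓕⁻ h : 𝓢(Rd d, ℂ)).smooth ⊤).contDiffAt.of_le
        (mod_cast le_top))
    rw [e, norm_smul, mul_assoc, mul_assoc, Finset.sum_mul]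
    refine mul_le_mul_of_nonneg_left ((norm_iteratedFDeriv_fourierInv_le h k ξ).trans
      (mul_le_mul_of_nonneg_left (Finset.sum_le_sum fun p hp => ?_) (by positivity)))
      (norm_nonneg _)
    have hv : ∀ v, ‖v‖ ^ p * ‖h v‖ ≤ (1 + ‖x‖) ^ k * ‖φ ((dilation d).symm v)‖ := by
      intro v
      rw [hh]
      by_cases hs : (dilation d).symm v ∈ tsupport φ
      · have h2 : v = (2 * Real.pi)⁻¹ • (dilation d).symm v :=
          ((dilation d).apply_symm_apply v).symm
        have h3 : ‖(dilation d).symm v‖ ≤ 1 + ‖x‖ := by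
          have := mem_closedBall_iff_norm.1 (hφ hs)
          have := norm_sub_norm_le ((dilation d).symm v) x
          linarith
        have h4 : ‖v‖ ≤ 1 + ‖x‖ := by
          rw [h2, norm_smul, norm_inv, Real.norm_of_nonneg (by positivity)]
          refine (mul_le_of_le_one_left (norm_nonneg _) (inv_le_one_of_one_le₀ ?_)).trans h3
          linarith [Real.pi_gt_three]
        gcongr
        calc ‖v‖ ^ p ≤ (1 + ‖x‖) ^ p := by gcongr
          _ ≤ (1 + ‖x‖) ^ k := pow_le_pow_right₀ (by linarith [norm_nonneg x])
            (Nat.lt_succ_iff.1 (Finset.mem_range.1 hp))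
      · rw [image_eq_zero_of_notMem_tsupport hs, norm_zero, mul_zero, mul_zero]
    calc ∫ v, ‖v‖ ^ p * ‖h v‖ ≤ ∫ v, (1 + ‖x‖) ^ k * ‖φ ((dilation d).symm v)‖ :=
          integral_mono (h.integrable_pow_mul volume p) (h.integrable.norm.const_mul _) hv
      _ = (1 + ‖x‖) ^ k * (J * ∫ v, ‖φ v‖) := by
          rw [integral_const_mul, integral_norm_comp_dilation_symm]
      _ ≤ (1 + ‖x‖) ^ k * (J * 1) := by gcongr
      _ = J * (1 + ‖x‖) ^ k := by ring

/-- A continuous function is bounded at `x` by its means against test functions concentrated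
near `x`. -/
theorem norm_le_of_forall_norm_integral_le {g : Rd d → ℂ} (hg : Continuous g) (x : Rd d) {B : ℝ}
    (h : ∀ φ : 𝓢(Rd d, ℂ), HasCompactSupport φ → tsupport φ ⊆ Metric.closedBall x 1 →
      ∫ y, ‖φ y‖ ≤ 1 → ‖∫ y, g y * φ y‖ ≤ B) : ‖g x‖ ≤ B := by
  refine le_of_forall_pos_le_add fun δ hδ => ?_
  obtain ⟨ε, hε, hεδ⟩ := Metric.continuousAt_iff.1 (hg.continuousAt (x := x)) δ hδ
  let r : ℝ := min ε 1
  have hr : 0 < r := lt_min hε one_pos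
  -- The radius is at most `1`, as the hypothesis requires, and at most `ε`, so that `g` varies by
  -- less than `δ` on the open ball where the normalized bump is nonzero.
  let b : ContDiffBump x := ⟨r / 2, r, half_pos hr, half_lt_self hr⟩
  let ρ : Rd d → ℝ := b.normed volume
  have hρ0 : ∀ y, 0 ≤ ρ y := b.nonneg_normed
  have hρi : Integrable ρ := b.integrable_normed
  have hρ1 : ∫ y, ρ y = 1 := b.integral_normed
  have hρs : Function.support ρ = Metric.ball x r := b.support_normed_eq
  have hρt : tsupport ρ = Metric.closedBall x r := b.tsupport_normed_eq
  have hρc : Continuous ρ := b.continuous_normed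
  have hsupp : Function.support (fun y => (ρ y : ℂ)) = Function.support ρ := by
    ext y
    simp
  have hc : HasCompactSupport fun y => (ρ y : ℂ) := by
    rw [HasCompactSupport, tsupport, hsupp, ← tsupport, hρt]
    exact isCompact_closedBall x r
  have hs : ContDiff ℝ ∞ fun y => (ρ y : ℂ) :=
    Complex.ofRealCLM.contDiff.comp (b.contDiff_normed (n := ⊤))
  have hb := h (hc.toSchwartzMap hs) hc
    (by
      change closure (Function.support fun y => (ρ y : ℂ)) ⊆ _
      rw [hsupp, ← tsupport, hρt]
      exact Metric.closedBall_subset_closedBall (min_le_right _ _))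
    (by
      change ∫ y, ‖(ρ y : ℂ)‖ ≤ 1
      simp only [Complex.norm_real, Real.norm_of_nonneg (hρ0 _), hρ1, le_refl])
  change ‖∫ y, g y * (ρ y : ℂ)‖ ≤ B at hb
  have hgi : Integrable fun y => g y * (ρ y : ℂ) :=
    integrable_mul_of_hasCompactSupport hg hs.continuous hc
  have hci : Integrable fun y => g x * (ρ y : ℂ) := hρi.ofReal.const_mul _
  have e : g x = ∫ y, g x * (ρ y : ℂ) := by
    rw [integral_const_mul, integral_complex_ofReal, hρ1, Complex.ofReal_one, mul_one]
  have hd : ‖g x - ∫ y, g y * (ρ y : ℂ)‖ ≤ δ := by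
    conv_lhs => rw [e]
    rw [← integral_sub hci hgi]
    calc _ ≤ ∫ y, δ * ρ y := by
          refine norm_integral_le_of_norm_le (hρi.const_mul δ) (Eventually.of_forall fun y => ?_)
          rw [← sub_mul, norm_mul, Complex.norm_real, Real.norm_of_nonneg (hρ0 y)]
          by_cases hy : y ∈ Metric.ball x r
          · have h1 := hεδ (lt_of_lt_of_le (Metric.mem_ball.1 hy) (min_le_left _ _))
            rw [dist_comm, dist_eq_norm] at h1
            have := hρ0 y
            gcongr
          · rw [← hρs, Function.mem_support, not_not] at hy
            rw [hy, mul_zero, mul_zero]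
      _ = δ := by rw [integral_const_mul, hρ1, mul_one]
  calc ‖g x‖ = ‖(∫ y, g y * (ρ y : ℂ)) + (g x - ∫ y, g y * (ρ y : ℂ))‖ := by
        rw [add_sub_cancel]
    _ ≤ B + δ := (norm_add_le _ _).trans (add_le_add hb hd)

theorem growthBound_of_dsupport_subset {f : Rd d → ℂ} (hf : ContDiff ℝ ∞ f) {T : 𝓢'(Rd d, ℂ)}
    (hT : Represents f T) (P : MvPolynomial (Fin d) ℂ) {R₀ : ℝ} (hR₀ : 0 ≤ R₀)
    (hK : IsCompact {ξ : Rd d | ‖evalI P ξ‖ ≤ R₀})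
    (hsupp : Distribution.dsupport (distFourier T) ⊆ {ξ | ‖evalI P ξ‖ ≤ R₀}) {N : ℕ}
    (hN : HasOrderAtMost (distFourier T) N) {R : ℝ} (hR : R₀ < R) :
    ∃ C : ℝ, 0 ≤ C ∧ GrowthBound P f N C R := by
  have hR0 : 0 < R := hR₀.trans_lt hR
  have hP := contDiff_evalI P
  obtain ⟨χ, hχc, hχO, hχ1, -⟩ := exists_cutoff hK
    (isOpen_lt hP.continuous.norm continuous_const : IsOpen {ξ : Rd d | ‖evalI P ξ‖ < R})
    (fun ξ hξ => lt_of_le_of_lt hξ hR)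
  obtain ⟨A, hA⟩ := hN _ hχc
  choose G hG hGb using fun l : ℕ => exists_bound_iteratedFDeriv_pow_smul hP hR0 l
    (χ.smooth ⊤) hχc (fun ξ hξ => le_of_lt (hχO hξ))
  obtain ⟨E, hE, hEw⟩ := exists_angularFourier_eq d
  let S : ℝ := ∑ k ∈ Finset.range (N + 1), ∑ i ∈ Finset.range (k + 1),
    (k.choose i : ℝ) * G i * E (k - i)
  have hS : 0 ≤ S := Finset.sum_nonneg fun k _ => Finset.sum_nonneg fun i _ => by
    have := hG i
    have := hE (k - i)
    positivity
  -- `2 ^ N` comes from `n + 1 ≤ 2 n`, valid as `n ≥ 1`; the absolute value is there because the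
  -- constant in the order estimate carries no sign.
  refine ⟨|A| * S * 2 ^ N, by positivity, fun n hn x => ?_⟩
  refine norm_le_of_forall_norm_integral_le (contDiff_polyDeriv_iterate hf P n).continuous x
    fun φ hφc hφ hφ1 => ?_
  obtain ⟨w, rfl, hw⟩ := hEw x φ hφ hφ1
  rw [← hT.apply_polyOp_pow hf P n hφc, ← angularFourier_polyOp_pow]
  let v : 𝓢(Rd d, ℂ) := (polyOp mulCoord P ^ n) w
  let u : 𝓢(Rd d, ℂ) := SchwartzMap.smulLeftCLM ℂ χ v
  have hu : ⇑u = fun ξ => (evalI P ξ ^ n • χ ξ) • w ξ := by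
    ext ξ
    rw [smulLeftCLM_schwartz_apply, polyOp_mulCoord_pow_apply, smul_eq_mul, smul_eq_mul]
    ring
  -- The cutoff equals `1` near the sublevel set, so `v - u` is supported off the support of `𝓕T`.
  -- Plain vanishing on that set would not suffice for this.
  have huv : distFourier T v = distFourier T u := by
    rw [← sub_eq_zero, ← map_sub]
    refine isVanishingOn_compl_dsupport _ _ ((tsupport_sub_smulLeftCLM_subset hχ1 v).trans ?_)
    exact fun ξ hξ h => hξ.2 (hsupp h)
  change ‖distFourier T v‖ ≤ _
  rw [huv]
  have hn' : (1 : ℝ) ≤ n := by exact_mod_cast hn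
  have hx1 : (1 : ℝ) ≤ 1 + ‖x‖ := by linarith [norm_nonneg x]
  have hsem : ∑ k ∈ Finset.range (N + 1), SchwartzMap.seminorm ℂ 0 k u ≤
      S * (((n : ℝ) + 1) ^ N * R ^ n * (1 + ‖x‖) ^ N) := by
    simp only [S, Finset.sum_mul]
    refine Finset.sum_le_sum fun k hk => ?_
    have hkN : k ≤ N := Nat.lt_succ_iff.1 (Finset.mem_range.1 hk)
    refine SchwartzMap.seminorm_le_bound ℂ 0 k _ (Finset.sum_nonneg fun i _ => by
      have := hG i
      have := hE (k - i)
      positivity) fun ξ => ?_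
    rw [pow_zero, one_mul, hu]
    refine (norm_iteratedFDeriv_smul_le (N := ∞) ((hP.pow n).smul (χ.smooth ⊤)) (w.smooth ⊤) ξ
      (mod_cast le_top)).trans (Finset.sum_le_sum fun i hi => ?_)
    have hik : i ≤ k := Nat.lt_succ_iff.1 (Finset.mem_range.1 hi)
    have h1 := hGb i n ξ
    have h2 := hw (k - i) ξ
    have h3 := hG i
    have h4 := hE (k - i)
    calc _ ≤ (k.choose i : ℝ) * (G i * ((n : ℝ) + 1) ^ i * R ^ n) *
          (E (k - i) * (1 + ‖x‖) ^ (k - i)) := by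
          gcongr
          exact h1
      _ ≤ (k.choose i : ℝ) * (G i * ((n : ℝ) + 1) ^ N * R ^ n) *
          (E (k - i) * (1 + ‖x‖) ^ N) := by
          gcongr
          · linarith
          · omega
          · omega
      _ = _ := by ring
  calc ‖distFourier T u‖ ≤ A * ∑ k ∈ Finset.range (N + 1), SchwartzMap.seminorm ℂ 0 k u :=
        hA u ((SchwartzMap.tsupport_smulLeftCLM_subset (𝕜 := ℂ) χ v).trans Set.inter_subset_right)
    _ ≤ |A| * (S * (((n : ℝ) + 1) ^ N * R ^ n * (1 + ‖x‖) ^ N)) :=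
        mul_le_mul (le_abs_self A) hsem (Finset.sum_nonneg fun k _ => apply_nonneg _ _)
          (abs_nonneg A)
    _ ≤ |A| * (S * ((2 * (n : ℝ)) ^ N * R ^ n * (1 + ‖x‖) ^ N)) := by
        gcongr
        linarith
    _ = _ := by
        rw [mul_pow]
        ring

end RealPaleyWiener

end

/-! ### The real Paley–Wiener theorem. -/

theorem mainTheorem7 (d : ℕ) (P : MvPolynomial (Fin d) ℂ)
    (f : RealPaleyWiener.Rd d → ℂ) (hf : ContDiff ℝ ∞ f)
    (T : 𝓢'(RealPaleyWiener.Rd d, ℂ)) (hT : RealPaleyWiener.Represents f T) :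
    (∀ R₀ : ℝ, 0 ≤ R₀ →
      IsCompact {ξ : RealPaleyWiener.Rd d | ‖RealPaleyWiener.evalI P ξ‖ ≤ R₀} →
      (Distribution.dsupport (RealPaleyWiener.distFourier T) ⊆
            {ξ | ‖RealPaleyWiener.evalI P ξ‖ ≤ R₀} ↔
          ∀ R : ℝ, R₀ < R → ∃ (N : ℕ) (C : ℝ), 0 ≤ C ∧ RealPaleyWiener.GrowthBound P f N C R) ∧
      (Distribution.dsupport (RealPaleyWiener.distFourier T) ⊆
            {ξ | ‖RealPaleyWiener.evalI P ξ‖ ≤ R₀} →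
          ∃ N : ℕ, RealPaleyWiener.distOrder (RealPaleyWiener.distFourier T) = N ∧
            ∀ R : ℝ, R₀ < R → ∃ C : ℝ, 0 ≤ C ∧ RealPaleyWiener.GrowthBound P f N C R)) ∧
    (∀ (N : ℕ) (C R : ℝ), 0 ≤ C → 0 ≤ R → RealPaleyWiener.GrowthBound P f N C R →
      Distribution.dsupport (RealPaleyWiener.distFourier T) ⊆
        {ξ | ‖RealPaleyWiener.evalI P ξ‖ ≤ R}) := by
  obtain ⟨N, hN, hN'⟩ :=
    RealPaleyWiener.exists_distOrder_eq (RealPaleyWiener.distFourier T)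
  refine ⟨fun R₀ hR₀ hK => ⟨⟨fun hs R hR => ?_, fun h ξ hξ => ?_⟩, fun hs => ⟨N, hN, fun R hR =>
      RealPaleyWiener.growthBound_of_dsupport_subset hf hT P hR₀ hK hs hN' hR⟩⟩,
    fun N C R _ hR h => RealPaleyWiener.dsupport_subset_of_growthBound hf hT P hR h⟩
  · exact ⟨N, RealPaleyWiener.growthBound_of_dsupport_subset hf hT P hR₀ hK hs hN' hR⟩
  · change ‖RealPaleyWiener.evalI P ξ‖ ≤ R₀
    -- Each `R > R₀` confines the support to `|P(iξ)| ≤ R`, whatever `N` and `C` are for that `R`;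
    -- let `R` decrease to `R₀`.
    refine le_of_forall_gt_imp_ge_of_dense fun R hR => ?_
    obtain ⟨N, C, -, hb⟩ := h R hR
    exact RealPaleyWiener.dsupport_subset_of_growthBound hf hT P (hR₀.trans hR.le) hb hξ
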